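/- Let $a:\mathbb R^2\to\mathbb R$, $a(x)=2+\sin\bigl(\ln(1+\ln(1+|x|))\bigr)$, and let $\Omega=\{x\in\mathbb R^2 : 1<|x|<2\}$. For $n\in\mathbb N$ put $$\varepsilon^1_n=\exp\bigl(-\exp(2n\pi)\bigr),\qquad \varepsilon^2_n=\exp\Bigl(-\exp\bigl((4n+1)\tfrac{\pi}{2}\bigr)\Bigr).$$ Then the following hold. (i) $a$ is uniformly elliptic (there is $\lambda>0$ with $\lambda|\xi|^2\le \langle a(x)\xi,\xi\rangle$ for all $x,\xi\in\mathbb R^2$), $a\in L^\infty(\mathbb R^2)$, and $a$ is bounded and uniformly $\alpha$-Hölder continuous on $\mathbb R^2$ for every $\alpha\in(0,1)$. Moreover $a\in L^1_{loc}(\mathbb R^2)$ and its discrete gradient $\delta a=\bigl(a(\cdot+e_i)-a\bigr)_{i=1,2}$ belongs to $L^2(\mathbb R^2)^2$. (ii) The sequences $(\varepsilon^1_n)$ and $(\varepsilon^2_n)$ are positive, strictly decreasing and tend to $0$; $a(\cdot/\varepsilon^1_n)\to 2$ and $a(\cdot/\varepsilon^2_n)\to 3$ uniformly on $\Omega$ as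 $n\to\infty$. (iii) Let $f\in L^2(\Omega)$. For every $\varepsilon>0$ the problem $-\operatorname{div}(a(\cdot/\varepsilon)\nabla u^\varepsilon)=f$ in $\Omega$, $u^\varepsilon=0$ on $\partial\Omega$, has a unique weak solution $u^\varepsilon\in H^1_0(\Omega)$, and the problems $$-2\Delta u^{*,1}=f \ \text{ in }\Omega,\quad u^{*,1}=0\ \text{ on }\partial\Omega,\qquad\qquad -3\Delta u^{*,2}=f \ \text{ in }\Omega,\quad u^{*,2}=0\ \text{ on }\partial\Omega,$$ have unique weak solutions $u^{*,1},u^{*,2}\in H^1_0(\Omega)$. As $n\to\infty$, $u^{\varepsilon^1_n}\to u^{*,1}$ and $u^{\varepsilon^2_n}\to u^{*,2}$, strongly in $L^2(\Omega)$ and weakly in $H^1(\Omega)$. (iv) If moreover $f\neq 0$ in $L^2(\Omega)$, then $u^{*,1}\ne u^{*,2}$, and $u^\varepsilon$ does not converge in $L^2(\Omega)$ as $\varepsilon\to0^+$. -/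

import Mathlib

open MeasureTheory Filter Topology Set
open scoped ENNReal ContDiff InnerProductSpace

noncomputable section

namespace Homogenization

/-- The Euclidean space `ℝᵈ`. -/
abbrev E (d : ℕ) := EuclideanSpace ℝ (Fin d)

/-- The `i`-th component `δᵢ g = g(· + eᵢ) - g` of the discrete gradient of `g`. -/
def discreteGradient {d : ℕ} (g : E d → ℝ) (i : Fin d) : E d → ℝ :=
  fun x => g (x + EuclideanSpace.single i 1) - g x

/-- The space `𝐀ᵖ` of locally integrable functions whose discrete gradient is in `Lᵖ(ℝᵈ)ᵈ`. -/
def discreteA (d : ℕ) (p : ℝ≥0∞) : Set (E d → ℝ) :=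
  {g | LocallyIntegrable g volume ∧ ∀ i, MemLp (discreteGradient g i) p volume}

/-- Uniform ellipticity of a scalar coefficient `a` (that is, of the matrix field `a(x) Id`). -/
def IsElliptic {d : ℕ} (a : E d → ℝ) : Prop :=
  ∃ lam > (0 : ℝ), ∀ x ξ : E d, lam * ‖ξ‖ ^ 2 ≤ ⟪a x • ξ, ξ⟫_ℝ

/-- `a ∈ C^{0,α}(ℝᵈ)`: `a` is bounded and uniformly `α`-Hölder continuous on `ℝᵈ`. -/
def IsBoundedHolder {d : ℕ} (α : ℝ) (a : E d → ℝ) : Prop :=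
  (∃ C : ℝ, ∀ x, |a x| ≤ C) ∧ ∃ C : ℝ, ∀ x y, |a x - a y| ≤ C * ‖x - y‖ ^ α

/-- `φ ∈ 𝒟(Ω)`: smooth with compact support contained in `Ω`. -/
structure IsTestFunction {d : ℕ} (Ω : Set (E d)) (φ : E d → ℝ) : Prop where
  smooth : ContDiff ℝ ∞ φ
  compact : HasCompactSupport φ
  support : tsupport φ ⊆ Ω

/-- `L²(Ω)`. -/
abbrev L2 {d : ℕ} (Ω : Set (E d)) := Lp ℝ 2 (volume.restrict Ω)

/-- `L²(Ω)ᵈ`. -/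
abbrev L2Vec {d : ℕ} (Ω : Set (E d)) := Lp (E d) 2 (volume.restrict Ω)

/-- `G` is the weak gradient of `u` on `Ω`. -/
def IsWeakGradient {d : ℕ} (Ω : Set (E d)) (u : L2 Ω) (G : L2Vec Ω) : Prop :=
  ∀ φ : E d → ℝ, IsTestFunction Ω φ →
    ∫ x in Ω, u x • gradient φ x = - ∫ x in Ω, φ x • G x

theorem IsTestFunction.continuous_gradient {d : ℕ} {Ω : Set (E d)} {φ : E d → ℝ}
    (h : IsTestFunction Ω φ) : Continuous (gradient φ) :=
  (InnerProductSpace.toDual ℝ (E d)).symm.continuous.comp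
    (h.smooth.continuous_fderiv (by simp))

theorem IsTestFunction.memLp {d : ℕ} {Ω : Set (E d)} {φ : E d → ℝ}
    (h : IsTestFunction Ω φ) : MemLp φ 2 (volume.restrict Ω) :=
  (h.smooth.continuous.memLp_of_hasCompactSupport h.compact).restrict Ω

theorem IsTestFunction.memLp_gradient {d : ℕ} {Ω : Set (E d)} {φ : E d → ℝ}
    (h : IsTestFunction Ω φ) : MemLp (gradient φ) 2 (volume.restrict Ω) :=
  (h.continuous_gradient.memLp_of_hasCompactSupport
    ((h.compact.fderiv ℝ).comp_left (map_zero _))).restrict Ω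

theorem IsWeakGradient.add {d : ℕ} {Ω : Set (E d)} {u v : L2 Ω} {G H : L2Vec Ω}
    (hu : IsWeakGradient Ω u G) (hv : IsWeakGradient Ω v H) :
    IsWeakGradient Ω (u + v) (G + H) := by
  intro φ hφ
  have e1 : ∫ x in Ω, (u + v : L2 Ω) x • gradient φ x
      = ∫ x in Ω, (u x • gradient φ x + v x • gradient φ x) := by
    refine integral_congr_ae ?_
    filter_upwards [Lp.coeFn_add u v] with x hx
    rw [hx, Pi.add_apply, add_smul]
  have e2 : ∫ x in Ω, φ x • (G + H : L2Vec Ω) x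
      = ∫ x in Ω, (φ x • G x + φ x • H x) := by
    refine integral_congr_ae ?_
    filter_upwards [Lp.coeFn_add G H] with x hx
    rw [hx, Pi.add_apply, smul_add]
  have i1 : ∀ w : L2 Ω, Integrable (fun x => w x • gradient φ x) (volume.restrict Ω) :=
    fun w => memLp_one_iff_integrable.1 (hφ.memLp_gradient.smul (Lp.memLp w))
  have i2 : ∀ W : L2Vec Ω, Integrable (fun x => φ x • W x) (volume.restrict Ω) :=
    fun W => memLp_one_iff_integrable.1 ((Lp.memLp W).smul hφ.memLp)
  rw [e1, e2, integral_add (i1 u) (i1 v), integral_add (i2 G) (i2 H), hu φ hφ, hv φ hφ, neg_add]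

theorem IsWeakGradient.smul {d : ℕ} {Ω : Set (E d)} {u : L2 Ω} {G : L2Vec Ω} (c : ℝ)
    (hu : IsWeakGradient Ω u G) : IsWeakGradient Ω (c • u) (c • G) := by
  intro φ hφ
  have e1 : ∫ x in Ω, (c • u : L2 Ω) x • gradient φ x
      = ∫ x in Ω, c • (u x • gradient φ x) := by
    refine integral_congr_ae ?_
    filter_upwards [Lp.coeFn_smul c u] with x hx
    rw [hx, Pi.smul_apply, smul_assoc]
  have e2 : ∫ x in Ω, φ x • (c • G : L2Vec Ω) x = ∫ x in Ω, c • (φ x • G x) := by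
    refine integral_congr_ae ?_
    filter_upwards [Lp.coeFn_smul c G] with x hx
    rw [hx, Pi.smul_apply, smul_comm]
  rw [e1, e2, integral_smul, integral_smul, hu φ hφ, smul_neg]

theorem IsWeakGradient.zero {d : ℕ} (Ω : Set (E d)) :
    IsWeakGradient Ω (0 : L2 Ω) (0 : L2Vec Ω) := by
  intro φ hφ
  have e1 : ∫ x in Ω, (0 : L2 Ω) x • gradient φ x = 0 := by
    refine integral_eq_zero_of_ae ?_
    filter_upwards [Lp.coeFn_zero ℝ 2 (volume.restrict Ω)] with x hx
    change (0 : L2 Ω) x • gradient φ x = 0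
    rw [hx]
    exact zero_smul ℝ _
  have e2 : ∫ x in Ω, φ x • (0 : L2Vec Ω) x = 0 := by
    refine integral_eq_zero_of_ae ?_
    filter_upwards [Lp.coeFn_zero (E d) 2 (volume.restrict Ω)] with x hx
    change φ x • (0 : L2Vec Ω) x = 0
    rw [hx]
    exact smul_zero _
  rw [e1, e2, neg_zero]

/-- The Sobolev space `H¹(Ω)`, with its norm `(‖u‖² + ‖∇u‖²)^{1/2}`: an element is a function of
`L²(Ω)` together with its weak gradient, which is required to be in `L²(Ω)ᵈ`. -/
def H1 {d : ℕ} (Ω : Set (E d)) : Submodule ℝ (WithLp 2 (L2 Ω × L2Vec Ω)) where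
  carrier := {w | IsWeakGradient Ω w.fst w.snd}
  add_mem' := fun hu hv => IsWeakGradient.add hu hv
  zero_mem' := IsWeakGradient.zero Ω
  smul_mem' := fun c _ hu => IsWeakGradient.smul c hu

/-- The underlying `L²` function of an element of `H¹(Ω)`. -/
def H1.fn {d : ℕ} {Ω : Set (E d)} (u : H1 Ω) : L2 Ω := (u : WithLp 2 (L2 Ω × L2Vec Ω)).fst

/-- The weak gradient of an element of `H¹(Ω)`. -/
def H1.grad {d : ℕ} {Ω : Set (E d)} (u : H1 Ω) : L2Vec Ω :=
  (u : WithLp 2 (L2 Ω × L2Vec Ω)).snd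

/-- `H¹₀(Ω)`: the closure in `H¹(Ω)` of the test functions on `Ω`. -/
def H10 {d : ℕ} (Ω : Set (E d)) : Submodule ℝ (H1 Ω) :=
  (Submodule.span ℝ {u : H1 Ω | ∃ φ : E d → ℝ, IsTestFunction Ω φ ∧
    H1.fn u =ᵐ[volume.restrict Ω] φ ∧ H1.grad u =ᵐ[volume.restrict Ω] gradient φ}).topologicalClosure

/-- `u ∈ H¹₀(Ω)` is a weak solution of `-div(a ∇u) = f` on `Ω`, `u = 0` on `∂Ω`. -/
def IsDirichletSolution {d : ℕ} (Ω : Set (E d)) (a : E d → ℝ) (f : L2 Ω) (u : H1 Ω) : Prop :=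
  u ∈ H10 Ω ∧ ∀ φ : E d → ℝ, IsTestFunction Ω φ →
    ∫ x in Ω, ⟪a x • H1.grad u x, gradient φ x⟫_ℝ = ∫ x in Ω, f x * φ x

/-- Weak convergence in `H¹(Ω)`. -/
def TendstoWeaklyH1 {d : ℕ} {Ω : Set (E d)} (u : ℕ → H1 Ω) (v : H1 Ω) : Prop :=
  ∀ l : H1 Ω →L[ℝ] ℝ, Tendsto (fun n => l (u n)) atTop (𝓝 (l v))

/-- The coefficient `a(x) = 2 + sin(ln(1 + ln(1 + |x|)))` on `ℝ²`. -/
def coeff (x : E 2) : ℝ := 2 + Real.sin (Real.log (1 + Real.log (1 + ‖x‖)))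

/-- The rescaled coefficient `a(·/ε)`. -/
def coeffScaled (ε : ℝ) (x : E 2) : ℝ := coeff (ε⁻¹ • x)

/-- The annulus `1 < |x| < 2` of `ℝ²`. -/
def annulus : Set (E 2) := {x | 1 < ‖x‖ ∧ ‖x‖ < 2}

/-- `ε¹ₙ = exp(-exp(2nπ))`. -/
def epsOne (n : ℕ) : ℝ := Real.exp (-Real.exp (2 * n * Real.pi))

/-- `ε²ₙ = exp(-exp((4n+1)π/2))`. -/
def epsTwo (n : ℕ) : ℝ := Real.exp (-Real.exp ((4 * n + 1) * (Real.pi / 2)))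

end Homogenization

end

open Homogenization

/-! The coefficient oscillates so slowly that blowing it up freezes it. With `ε = exp (-T)` one has
`log (1 + |x|/ε) = T + log (ε + |x|)`, and on the annulus the second term is bounded. Hence `a(x/ε)
= 2 + sin (log T) + O(1/T)` uniformly there (`abs_coeffScaled_sub_le`): asymptotically constant in
`x`, but with a value that depends on the scale. The two sequences take `log T` equal to `2nπ` and
`π/2 + 2nπ`, which gives the constants 2 and 3.

Admissibility is the borderline case of a logarithmic integral. The discrete gradient is `O(1 / ((1
+ r)(1 + log (1 + r))))`, and its square times the planar Jacobian `r` is dominated by the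
derivative of `-1 / (1 + log (1 + r))`.

Existence and uniqueness come from Lax-Milgram, coercivity on `H10` being the Poincaré inequality.
Uniform convergence of coefficients then passes to solutions: subtracting the two equations and
testing with the difference gives `lam * ‖∇(u - v)‖ ≤ sup |b - a| * ‖∇v‖` (`norm_grad_sub_le`). This
yields strong convergence in `H1`, from which the strong `L2` and weak `H1` convergences both
follow.

Finally `u₂ = (2/3) u₁`, so equality of the limits forces `u₁ = 0` and then `f = 0`. For `f ≠ 0` the
two sequences of scales therefore have distinct limits, which rules out convergence as `ε → 0⁺`. -/

namespace Homogenization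

/-! ### The coefficient -/

/-- The radial profile of `coeff`. -/
noncomputable def radialProfile (t : ℝ) : ℝ := Real.sin (Real.log (1 + Real.log (1 + t)))

theorem coeff_eq (x : E 2) : coeff x = 2 + radialProfile ‖x‖ := rfl

theorem one_le_one_add_log {t : ℝ} (ht : 0 ≤ t) : 1 ≤ 1 + Real.log (1 + t) := by
  have := Real.log_nonneg (show (1 : ℝ) ≤ 1 + t by linarith)
  linarith

theorem log_sub_log_le {x y : ℝ} (hx : 0 < x) (hy : 0 < y) :
    Real.log y - Real.log x ≤ (y - x) / x := by
  rw [← Real.log_div hy.ne' hx.ne', sub_div, div_self hx.ne']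
  exact Real.log_le_sub_one_of_pos (div_pos hy hx)

/-- The sine is 1-Lipschitz, and the tangent-line bound for the concave logarithm is applied twice,
each time at the smaller endpoint `t`. -/
theorem abs_radialProfile_sub_le {s t : ℝ} (ht : 0 ≤ t) (hts : t ≤ s) :
    |radialProfile s - radialProfile t| ≤ (s - t) / ((1 + t) * (1 + Real.log (1 + t))) := by
  have h1t := one_le_one_add_log ht
  have h1s := one_le_one_add_log (ht.trans hts)
  have hlog : Real.log (1 + t) ≤ Real.log (1 + s) :=
    Real.log_le_log (by linarith) (by linarith)
  have hA := log_sub_log_le (show 0 < 1 + Real.log (1 + t) by linarith)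
    (show 0 < 1 + Real.log (1 + s) by linarith)
  have hB := log_sub_log_le (show 0 < 1 + t by linarith) (show 0 < 1 + s by linarith)
  have hmono : Real.log (1 + Real.log (1 + t)) ≤ Real.log (1 + Real.log (1 + s)) :=
    Real.log_le_log (by linarith) (by linarith)
  refine (Real.abs_sin_sub_sin_le _ _).trans ?_
  rw [abs_of_nonneg (sub_nonneg.2 hmono), ← div_div]
  refine hA.trans ?_
  gcongr
  calc 1 + Real.log (1 + s) - (1 + Real.log (1 + t))
      = Real.log (1 + s) - Real.log (1 + t) := by ring
    _ ≤ (1 + s - (1 + t)) / (1 + t) := hB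
    _ = (s - t) / (1 + t) := by ring_nf

theorem abs_radialProfile_sub_le_abs {s t : ℝ} (hs : 0 ≤ s) (ht : 0 ≤ t) :
    |radialProfile s - radialProfile t| ≤ |s - t| := by
  have key : ∀ {s t : ℝ}, 0 ≤ t → t ≤ s → |radialProfile s - radialProfile t| ≤ |s - t| := by
    intro s t ht hts
    refine (abs_radialProfile_sub_le ht hts).trans ?_
    rw [abs_of_nonneg (sub_nonneg.2 hts)]
    refine div_le_self (sub_nonneg.2 hts) ?_
    have := one_le_one_add_log ht
    nlinarith
  rcases le_total t s with h | h
  · exact key ht h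
  · rw [abs_sub_comm, abs_sub_comm s t]
    exact key hs h

theorem abs_coeff_sub_le (x y : E 2) : |coeff x - coeff y| ≤ ‖x - y‖ := by
  rw [coeff_eq, coeff_eq, add_sub_add_left_eq_sub]
  exact (abs_radialProfile_sub_le_abs (norm_nonneg x) (norm_nonneg y)).trans
    (abs_norm_sub_norm_le x y)

theorem one_le_coeff (x : E 2) : 1 ≤ coeff x := by
  have := Real.neg_one_le_sin (Real.log (1 + Real.log (1 + ‖x‖)))
  unfold coeff
  linarith

theorem coeff_le_three (x : E 2) : coeff x ≤ 3 := by
  have := Real.sin_le_one (Real.log (1 + Real.log (1 + ‖x‖)))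
  unfold coeff
  linarith

theorem abs_coeff_le_three (x : E 2) : |coeff x| ≤ 3 :=
  abs_le.2 ⟨by linarith [one_le_coeff x], coeff_le_three x⟩

theorem continuous_coeff : Continuous coeff := by
  refine (LipschitzWith.of_dist_le_mul (K := 1) fun x y => ?_).continuous
  simpa [Real.dist_eq, dist_eq_norm] using abs_coeff_sub_le x y

theorem isElliptic_coeff : IsElliptic coeff := by
  refine ⟨1, one_pos, fun x ξ => ?_⟩
  rw [real_inner_smul_left, real_inner_self_eq_norm_sq]
  exact mul_le_mul_of_nonneg_right (one_le_coeff x) (sq_nonneg _)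

theorem isBoundedHolder_coeff {α : ℝ} (hα : α ∈ Ioo (0 : ℝ) 1) : IsBoundedHolder α coeff := by
  -- The constant 2 is the oscillation of values in `[1, 3]`, used at distance at least 1; at
  -- shorter distance the Lipschitz bound is stronger than the Hölder one.
  refine ⟨⟨3, abs_coeff_le_three⟩, 2, fun x y => ?_⟩
  rcases le_total ‖x - y‖ 1 with h | h
  · have h1 : ‖x - y‖ ≤ ‖x - y‖ ^ α := by
      rcases (norm_nonneg (x - y)).eq_or_lt with h0 | h0
      · rw [← h0]
        exact Real.rpow_nonneg le_rfl _
      · simpa using Real.rpow_le_rpow_of_exponent_ge h0 h hα.2.le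
    linarith [abs_coeff_sub_le x y, norm_nonneg (x - y)]
  · have h1 : 1 ≤ ‖x - y‖ ^ α := Real.one_le_rpow h hα.1.le
    have h2 : |coeff x - coeff y| ≤ 2 :=
      abs_le.2 ⟨by linarith [one_le_coeff x, coeff_le_three y],
        by linarith [one_le_coeff y, coeff_le_three x]⟩
    linarith

/-- The decay rate of the discrete gradient of `coeff`. -/
noncomputable def decayRate (t : ℝ) : ℝ := ((1 + t) * (1 + Real.log (1 + t)))⁻¹

/-- The increment over a unit step is controlled by the rate at the smaller of two norms that differ
by at most 1. This moves the estimate back to `‖x‖`; each factor changes at most by a factor 2, so 8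
leaves room. -/
theorem decayRate_le {s t : ℝ} (hs : 0 ≤ s) (ht : 0 ≤ t) (hts : t ≤ s + 1) :
    decayRate s ≤ 8 * decayRate t := by
  have h1s := one_le_one_add_log hs
  have h1t := one_le_one_add_log ht
  have hlog : Real.log (1 + t) ≤ Real.log 2 + Real.log (1 + s) := by
    rw [← Real.log_mul (by norm_num) (by linarith)]
    exact Real.log_le_log (by linarith) (by linarith)
  have hlog2 := Real.log_two_lt_d9
  unfold decayRate
  rw [← div_eq_mul_inv, inv_eq_one_div, div_le_div_iff₀ (by positivity) (by positivity), one_mul]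
  calc (1 + t) * (1 + Real.log (1 + t))
      ≤ (2 * (1 + s)) * (2 * (1 + Real.log (1 + s))) := by
        gcongr
        · linarith
        · linarith
    _ ≤ 8 * ((1 + s) * (1 + Real.log (1 + s))) := by
        nlinarith [mul_nonneg (show 0 ≤ 1 + s by linarith)
          (show 0 ≤ 1 + Real.log (1 + s) by linarith)]

theorem abs_discreteGradient_coeff_le (i : Fin 2) (x : E 2) :
    |discreteGradient coeff i x| ≤ 8 * decayRate ‖x‖ := by
  have hd : |‖x + EuclideanSpace.single i 1‖ - ‖x‖| ≤ 1 := by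
    simpa using abs_norm_sub_norm_le (x + EuclideanSpace.single i (1 : ℝ)) x
  have hx := norm_nonneg x
  have hy := norm_nonneg (x + EuclideanSpace.single i (1 : ℝ))
  have key : ∀ {s t : ℝ}, 0 ≤ t → t ≤ s → s ≤ t + 1 →
      |radialProfile s - radialProfile t| ≤ decayRate t := by
    intro s t ht hts hst
    have h1 := one_le_one_add_log ht
    refine (abs_radialProfile_sub_le ht hts).trans ?_
    rw [decayRate, inv_eq_one_div]
    gcongr
    linarith
  unfold discreteGradient
  rw [coeff_eq, coeff_eq, add_sub_add_left_eq_sub]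
  rw [abs_le] at hd
  rcases le_total ‖x‖ ‖x + EuclideanSpace.single i (1 : ℝ)‖ with h | h
  · exact (key hx h (by linarith)).trans (decayRate_le hx hx (by linarith))
  · rw [abs_sub_comm]
    exact (key hy h (by linarith)).trans (decayRate_le hy hx (by linarith))

/-- Supplies a bounded primitive of `1 / ((1 + t)(1 + log (1 + t))²)`, the majorant of the radial
integral below. -/
theorem hasDerivAt_neg_inv_one_add_log {t : ℝ} (ht : 0 ≤ t) :
    HasDerivAt (fun t => -(1 + Real.log (1 + t))⁻¹)
      ((1 + t) * decayRate t ^ 2) t := by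
  have h1 := one_le_one_add_log ht
  have h2 : HasDerivAt (fun t : ℝ => 1 + Real.log (1 + t)) (1 / (1 + t)) t :=
    (((hasDerivAt_id t).const_add 1).log (by simp; linarith)).const_add 1
  refine (h2.inv (by linarith)).neg.congr_deriv ?_
  unfold decayRate
  have : 1 + t ≠ 0 := by linarith
  have : 1 + Real.log (1 + t) ≠ 0 := by linarith
  field_simp

theorem continuousOn_decayRate : ContinuousOn decayRate (Ici 0) := by
  unfold decayRate
  refine ContinuousOn.inv₀ (ContinuousOn.mul (by fun_prop) (continuousOn_const.add
    (ContinuousOn.log (by fun_prop) fun t ht => ?_))) fun t ht => ?_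
  · have : 0 ≤ t := ht
    linarith
  · have h1 : 0 ≤ t := ht
    have h2 := one_le_one_add_log h1
    positivity

/-- Polar coordinates in the plane reduce this to `t * decayRate t ^ 2` on the half-line. Enlarging
the Jacobian `t` to `1 + t` gives an exact nonnegative derivative whose primitive tends to 0 at
infinity. -/
theorem integrable_decayRate_norm_sq : Integrable (fun x : E 2 => decayRate ‖x‖ ^ 2) volume := by
  have key := integrable_fun_norm_addHaar (E := E 2) (volume : Measure (E 2))
    (f := fun t => decayRate t ^ 2)
  rw [key]
  have hlim : Tendsto (fun t : ℝ => -(1 + Real.log (1 + t))⁻¹) atTop (𝓝 (-0)) := by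
    refine (Tendsto.inv_tendsto_atTop ?_).neg
    exact tendsto_atTop_add_const_left _ _
      (Real.tendsto_log_atTop.comp (tendsto_atTop_add_const_left _ _ tendsto_id))
  have hint : IntegrableOn (fun t : ℝ => (1 + t) * decayRate t ^ 2) (Ioi 0) :=
    integrableOn_Ioi_deriv_of_nonneg' (fun t ht => hasDerivAt_neg_inv_one_add_log ht)
      (fun t ht => mul_nonneg (by linarith [mem_Ioi.1 ht]) (sq_nonneg _)) hlim
  refine Integrable.mono' hint ?_ ?_
  · refine ContinuousOn.aestronglyMeasurable ?_ measurableSet_Ioi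
    exact ContinuousOn.smul (continuous_pow _).continuousOn
      ((continuousOn_decayRate.mono Ioi_subset_Ici_self).pow 2)
  · refine (ae_restrict_iff' measurableSet_Ioi).2 (ae_of_all _ fun t ht => ?_)
    have ht : 0 < t := ht
    simp only [finrank_euclideanSpace, Fintype.card_fin, smul_eq_mul, Nat.add_one_sub_one,
      pow_one]
    rw [Real.norm_of_nonneg (by positivity)]
    gcongr
    linarith

theorem coeff_mem_discreteA : coeff ∈ discreteA 2 2 := by
  refine ⟨continuous_coeff.locallyIntegrable, fun i => ?_⟩
  have hc : Continuous (discreteGradient coeff i) :=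
    (continuous_coeff.comp (by fun_prop)).sub continuous_coeff
  rw [memLp_two_iff_integrable_sq hc.aestronglyMeasurable]
  refine (integrable_decayRate_norm_sq.const_mul 64).mono' (hc.pow 2).aestronglyMeasurable
    (ae_of_all _ fun x => ?_)
  rw [Real.norm_of_nonneg (sq_nonneg _), ← sq_abs]
  calc |discreteGradient coeff i x| ^ 2 ≤ (8 * decayRate ‖x‖) ^ 2 := by
        gcongr
        exact abs_discreteGradient_coeff_le i x
    _ = 64 * decayRate ‖x‖ ^ 2 := by ring

theorem memLp_coeff : MemLp coeff ∞ volume :=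
  memLp_top_of_bound continuous_coeff.aestronglyMeasurable 3 (ae_of_all _ abs_coeff_le_three)

/-! ### The scales -/

/-- Factoring `exp T` out of the logarithm leaves `r = log (exp (-T) + ‖x‖)`, which lies in `[0, 2]`
since its argument is between 1 and 3. Then `log (1 + T + r) - log T ≤ (1 + r) / T`, whence the 3.
-/
theorem abs_coeffScaled_sub_le {T : ℝ} (hT : 0 < T) {x : E 2} (hx : x ∈ annulus) :
    |coeffScaled (Real.exp (-T)) x - (2 + Real.sin (Real.log T))| ≤ 3 / T := by
  obtain ⟨hx1, hx2⟩ := hx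
  have he : 0 < Real.exp (-T) := Real.exp_pos _
  have he1 : Real.exp (-T) ≤ 1 := Real.exp_le_one_iff.2 (by linarith)
  have hlog : Real.log (1 + ‖(Real.exp (-T))⁻¹ • x‖) = T + Real.log (Real.exp (-T) + ‖x‖) := by
    rw [norm_smul, norm_inv, Real.norm_of_nonneg he.le,
      show 1 + (Real.exp (-T))⁻¹ * ‖x‖ = Real.exp T * (Real.exp (-T) + ‖x‖) by
        rw [mul_add, ← Real.exp_add, Real.exp_neg]
        simp,
      Real.log_mul (Real.exp_pos T).ne' (by positivity), Real.log_exp]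
  have h0 : 0 ≤ Real.log (Real.exp (-T) + ‖x‖) := Real.log_nonneg (by linarith)
  have h2 : Real.log (Real.exp (-T) + ‖x‖) ≤ 2 :=
    (Real.log_le_sub_one_of_pos (by positivity)).trans (by linarith)
  unfold coeffScaled coeff
  rw [add_sub_add_left_eq_sub, hlog]
  refine (Real.abs_sin_sub_sin_le _ _).trans ?_
  rw [abs_of_nonneg (sub_nonneg.2 (Real.log_le_log hT (by linarith)))]
  refine (log_sub_log_le hT (by linarith)).trans ?_
  gcongr
  linarith

theorem tendstoUniformlyOn_coeffScaled {T : ℕ → ℝ} (hT : ∀ n, 0 < T n)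
    (hlim : Tendsto T atTop atTop) {c : ℝ} (hc : ∀ n, 2 + Real.sin (Real.log (T n)) = c) :
    TendstoUniformlyOn (fun n => coeffScaled (Real.exp (-T n))) (fun _ => c) atTop annulus := by
  rw [Metric.tendstoUniformlyOn_iff]
  intro δ hδ
  have h3 : Tendsto (fun n => 3 / T n) atTop (𝓝 0) := hlim.const_div_atTop 3
  filter_upwards [h3.eventually_lt_const hδ] with n hn x hx
  rw [dist_comm, Real.dist_eq, ← hc n]
  exact (abs_coeffScaled_sub_le (hT n) hx).trans_lt hn

theorem strictMono_scaleOne : StrictMono fun n : ℕ => 2 * (n : ℝ) * Real.pi := by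
  intro m n h
  have : (m : ℝ) < n := by exact_mod_cast h
  have := Real.pi_pos
  dsimp only
  gcongr

theorem strictMono_scaleTwo : StrictMono fun n : ℕ => (4 * (n : ℝ) + 1) * (Real.pi / 2) := by
  intro m n h
  have : (m : ℝ) < n := by exact_mod_cast h
  have := Real.pi_pos
  dsimp only
  gcongr

theorem tendsto_scaleOne : Tendsto (fun n : ℕ => 2 * (n : ℝ) * Real.pi) atTop atTop :=
  (tendsto_natCast_atTop_atTop.const_mul_atTop two_pos).atTop_mul_const Real.pi_pos

theorem tendsto_scaleTwo :
    Tendsto (fun n : ℕ => (4 * (n : ℝ) + 1) * (Real.pi / 2)) atTop atTop :=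
  (tendsto_atTop_add_const_right _ _
    (tendsto_natCast_atTop_atTop.const_mul_atTop four_pos)).atTop_mul_const Real.pi_div_two_pos

theorem tendsto_exp_neg_exp {s : ℕ → ℝ} (hs : Tendsto s atTop atTop) :
    Tendsto (fun n => Real.exp (-Real.exp (s n))) atTop (𝓝 0) :=
  Real.tendsto_exp_neg_atTop_nhds_zero.comp (Real.tendsto_exp_atTop.comp hs)

theorem strictAnti_exp_neg_exp {s : ℕ → ℝ} (hs : StrictMono s) :
    StrictAnti fun n => Real.exp (-Real.exp (s n)) := fun m n h => by
  dsimp only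
  have := hs h
  gcongr

theorem tendstoUniformlyOn_coeffScaled_epsOne :
    TendstoUniformlyOn (fun n => coeffScaled (epsOne n)) (fun _ => 2) atTop annulus := by
  refine tendstoUniformlyOn_coeffScaled (fun n => Real.exp_pos _)
    (Real.tendsto_exp_atTop.comp tendsto_scaleOne) fun n => ?_
  rw [Real.log_exp, show 2 * (n : ℝ) * Real.pi = ((2 * n : ℕ) : ℝ) * Real.pi by push_cast; ring,
    Real.sin_nat_mul_pi, add_zero]

theorem tendstoUniformlyOn_coeffScaled_epsTwo :
    TendstoUniformlyOn (fun n => coeffScaled (epsTwo n)) (fun _ => 3) atTop annulus := by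
  refine tendstoUniformlyOn_coeffScaled (fun n => Real.exp_pos _)
    (Real.tendsto_exp_atTop.comp tendsto_scaleTwo) fun n => ?_
  rw [Real.log_exp, show (4 * (n : ℝ) + 1) * (Real.pi / 2) = Real.pi / 2 + n * (2 * Real.pi) by
    ring, Real.sin_add_nat_mul_two_pi, Real.sin_pi_div_two]
  norm_num

end Homogenization

namespace Homogenization

variable {d : ℕ} {Ω : Set (E d)}

/-! ### Test functions as elements of `H¹(Ω)` -/

namespace IsTestFunction

variable {φ ψ : E d → ℝ}

theorem add (hφ : IsTestFunction Ω φ) (hψ : IsTestFunction Ω ψ) :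
    IsTestFunction Ω (φ + ψ) where
  smooth := hφ.smooth.add hψ.smooth
  compact := hφ.compact.add hψ.compact
  support := (tsupport_add φ ψ).trans (union_subset hφ.support hψ.support)

theorem const_smul (hφ : IsTestFunction Ω φ) (c : ℝ) : IsTestFunction Ω (c • φ) where
  smooth := hφ.smooth.const_smul c
  compact := hφ.compact.smul_left (f := fun _ => c)
  support := (tsupport_smul_subset_right (fun _ => c) φ).trans hφ.support

theorem zero : IsTestFunction Ω (0 : E d → ℝ) where
  smooth := contDiff_const
  compact := HasCompactSupport.zero
  support := by simp [tsupport]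

theorem differentiable (hφ : IsTestFunction Ω φ) : Differentiable ℝ φ :=
  hφ.smooth.differentiable (by simp)

theorem continuous_fderiv_apply (hφ : IsTestFunction Ω φ) (v : E d) :
    Continuous fun x => fderiv ℝ φ x v :=
  (hφ.smooth.continuous_fderiv (by simp)).clm_apply continuous_const

theorem hasCompactSupport_fderiv_apply (hφ : IsTestFunction Ω φ) (v : E d) :
    HasCompactSupport fun x => fderiv ℝ φ x v :=
  (hφ.compact.fderiv ℝ).comp_left (g := fun L : E d →L[ℝ] ℝ => L v) rfl

theorem gradient_eq_zero (hφ : IsTestFunction Ω φ) {x : E d} (hx : x ∉ Ω) :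
    gradient φ x = 0 := by
  have : fderiv ℝ φ x = 0 :=
    image_eq_zero_of_notMem_tsupport fun h => hx (hφ.support (tsupport_fderiv_subset ℝ h))
  rw [gradient, this, map_zero]

theorem eq_zero (hφ : IsTestFunction Ω φ) {x : E d} (hx : x ∉ Ω) : φ x = 0 :=
  image_eq_zero_of_notMem_tsupport fun h => hx (hφ.support h)

theorem integral_mul_fderiv (hφ : IsTestFunction Ω φ) (hψ : IsTestFunction Ω ψ) (v : E d) :
    ∫ x, φ x * fderiv ℝ ψ x v = -∫ x, fderiv ℝ φ x v * ψ x :=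
  integral_mul_fderiv_eq_neg_fderiv_mul_of_integrable
    (((hφ.continuous_fderiv_apply v).mul hψ.smooth.continuous).integrable_of_hasCompactSupport
      (hψ.compact.mul_left))
    ((hφ.smooth.continuous.mul (hψ.continuous_fderiv_apply v)).integrable_of_hasCompactSupport
      (hφ.compact.mul_right))
    ((hφ.smooth.continuous.mul hψ.smooth.continuous).integrable_of_hasCompactSupport
      (hφ.compact.mul_right))
    (fun x _ => hφ.differentiable x) (fun x _ => hψ.differentiable x)

/-- Both integrands vanish off `Ω`, so the integrals extend to the whole space, where integration by
parts in each direction has no boundary term and `Ω` needs no regularity. -/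
theorem isWeakGradient (hφ : IsTestFunction Ω φ) :
    IsWeakGradient Ω (hφ.memLp.toLp φ) (hφ.memLp_gradient.toLp (gradient φ)) := by
  intro ψ hψ
  have e1 : ∫ x in Ω, hφ.memLp.toLp φ x • gradient ψ x = ∫ x, φ x • gradient ψ x := by
    rw [← setIntegral_eq_integral_of_forall_compl_eq_zero (s := Ω)
      (f := fun x => φ x • gradient ψ x) fun x hx => by rw [hψ.gradient_eq_zero hx, smul_zero]]
    refine integral_congr_ae ?_
    filter_upwards [hφ.memLp.coeFn_toLp] with x hx
    rw [hx]
  have e2 : ∫ x in Ω, ψ x • hφ.memLp_gradient.toLp (gradient φ) x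
      = ∫ x, ψ x • gradient φ x := by
    rw [← setIntegral_eq_integral_of_forall_compl_eq_zero (s := Ω)
      (f := fun x => ψ x • gradient φ x) fun x hx => by rw [hψ.eq_zero hx, zero_smul]]
    refine integral_congr_ae ?_
    filter_upwards [hφ.memLp_gradient.coeFn_toLp] with x hx
    rw [hx]
  have i1 : Integrable (fun x => φ x • gradient ψ x) volume :=
    (hφ.smooth.continuous.smul hψ.continuous_gradient).integrable_of_hasCompactSupport
      hφ.compact.smul_right
  have i2 : Integrable (fun x => ψ x • gradient φ x) volume :=
    (hψ.smooth.continuous.smul hφ.continuous_gradient).integrable_of_hasCompactSupport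
      hψ.compact.smul_right
  rw [e1, e2]
  refine ext_inner_left ℝ fun v => ?_
  rw [inner_neg_right, ← integral_inner i1, ← integral_inner i2]
  simp only [inner_smul_right, inner_gradient_right, conj_trivial]
  rw [hφ.integral_mul_fderiv hψ v]
  simp only [mul_comm]

/-- A test function on `Ω`, as an element of `H¹(Ω)`. -/
noncomputable def toH1 (hφ : IsTestFunction Ω φ) : H1 Ω :=
  ⟨WithLp.toLp 2 (hφ.memLp.toLp φ, hφ.memLp_gradient.toLp (gradient φ)), hφ.isWeakGradient⟩

theorem fn_toH1 (hφ : IsTestFunction Ω φ) : H1.fn hφ.toH1 =ᵐ[volume.restrict Ω] φ :=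
  hφ.memLp.coeFn_toLp

theorem grad_toH1 (hφ : IsTestFunction Ω φ) :
    H1.grad hφ.toH1 =ᵐ[volume.restrict Ω] gradient φ :=
  hφ.memLp_gradient.coeFn_toLp

theorem toH1_mem (hφ : IsTestFunction Ω φ) : hφ.toH1 ∈ H10 Ω :=
  Submodule.le_topologicalClosure _
    (Submodule.subset_span ⟨φ, hφ, hφ.fn_toH1, hφ.grad_toH1⟩)

end IsTestFunction

/-! ### The Hilbert space `H¹(Ω)` -/

theorem H1.ext {u v : H1 Ω} (h₁ : H1.fn u = H1.fn v) (h₂ : H1.grad u = H1.grad v) : u = v :=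
  Subtype.ext ((WithLp.ofLp_injective 2) (Prod.ext h₁ h₂))

theorem H1.norm_sq (u : H1 Ω) : ‖u‖ ^ 2 = ‖H1.fn u‖ ^ 2 + ‖H1.grad u‖ ^ 2 :=
  WithLp.prod_norm_sq_eq_of_L2 _

/-- The inclusion `H¹(Ω) → L²(Ω)`. -/
noncomputable def H1.fnL (Ω : Set (E d)) : H1 Ω →L[ℝ] L2 Ω :=
  (WithLp.fstL 2 ℝ (L2 Ω) (L2Vec Ω)).comp (H1 Ω).subtypeL

/-- The weak gradient `H¹(Ω) → L²(Ω)ᵈ`. -/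
noncomputable def H1.gradL (Ω : Set (E d)) : H1 Ω →L[ℝ] L2Vec Ω :=
  (WithLp.sndL 2 ℝ (L2 Ω) (L2Vec Ω)).comp (H1 Ω).subtypeL

/-- Each test function imposes one equation between continuous `L²` pairings. Closedness gives the
completeness needed for Lax-Milgram. -/
theorem isClosed_H1 : IsClosed (H1 Ω : Set (WithLp 2 (L2 Ω × L2Vec Ω))) := by
  have h : (H1 Ω : Set (WithLp 2 (L2 Ω × L2Vec Ω))) =
      ⋂ (φ : E d → ℝ) (_ : IsTestFunction Ω φ),
        {w | ∫ x in Ω, w.fst x • gradient φ x = - ∫ x in Ω, φ x • w.snd x} := by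
    ext w
    simp only [mem_iInter]
    rfl
  rw [h]
  refine isClosed_iInter fun φ => isClosed_iInter fun hφ => ?_
  have e1 : ∀ w : WithLp 2 (L2 Ω × L2Vec Ω), ∫ x in Ω, w.fst x • gradient φ x =
      (ContinuousLinearMap.lsmul ℝ ℝ).lpPairing (volume.restrict Ω) 2 2 w.fst
        (hφ.memLp_gradient.toLp (gradient φ)) := by
    intro w
    rw [ContinuousLinearMap.lpPairing_eq_integral]
    refine integral_congr_ae ?_
    filter_upwards [hφ.memLp_gradient.coeFn_toLp] with x hx
    rw [hx, ContinuousLinearMap.lsmul_apply]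
  have e2 : ∀ w : WithLp 2 (L2 Ω × L2Vec Ω), ∫ x in Ω, φ x • w.snd x =
      (ContinuousLinearMap.lsmul ℝ ℝ).lpPairing (volume.restrict Ω) 2 2 (hφ.memLp.toLp φ)
        w.snd := by
    intro w
    rw [ContinuousLinearMap.lpPairing_eq_integral]
    refine integral_congr_ae ?_
    filter_upwards [hφ.memLp.coeFn_toLp] with x hx
    rw [hx, ContinuousLinearMap.lsmul_apply]
  simp only [e1, e2]
  have c1 : Continuous fun w : WithLp 2 (L2 Ω × L2Vec Ω) => w.fst :=
    (WithLp.fstL 2 ℝ (L2 Ω) (L2Vec Ω)).continuous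
  have c2 : Continuous fun w : WithLp 2 (L2 Ω × L2Vec Ω) => w.snd :=
    (WithLp.sndL 2 ℝ (L2 Ω) (L2Vec Ω)).continuous
  exact isClosed_eq (by fun_prop) (by fun_prop)

instance completeSpace_H1 : CompleteSpace (H1 Ω) :=
  isClosed_H1.completeSpace_coe

instance completeSpace_H10 : CompleteSpace (H10 Ω) :=
  (Submodule.isClosed_topologicalClosure _).completeSpace_coe

/-- Test functions already form a vector space, so the span in `H10` adds nothing and only the
closure has to be handled. -/
theorem H10_induction {S : Set (H1 Ω)} (hS : IsClosed S)
    (h : ∀ (φ : E d → ℝ) (hφ : IsTestFunction Ω φ), hφ.toH1 ∈ S) {u : H1 Ω} (hu : u ∈ H10 Ω) :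
    u ∈ S := by
  refine closure_minimal (fun v hv => ?_) hS hu
  obtain ⟨φ, hφ, h1, h2⟩ : ∃ φ : E d → ℝ, IsTestFunction Ω φ ∧
      H1.fn v =ᵐ[volume.restrict Ω] φ ∧ H1.grad v =ᵐ[volume.restrict Ω] gradient φ := by
    refine Submodule.span_induction (p := fun v _ => ∃ φ : E d → ℝ, IsTestFunction Ω φ ∧
      H1.fn v =ᵐ[volume.restrict Ω] φ ∧ H1.grad v =ᵐ[volume.restrict Ω] gradient φ)
      (fun v hv => hv) ?_ ?_ ?_ hv
    · refine ⟨0, IsTestFunction.zero, Lp.coeFn_zero _ _ _, (Lp.coeFn_zero _ _ _).trans ?_⟩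
      exact ae_of_all _ fun x => (gradient_const x (0 : ℝ)).symm
    · rintro v w - - ⟨φ, hφ, a1, a2⟩ ⟨ψ, hψ, b1, b2⟩
      refine ⟨φ + ψ, hφ.add hψ, (Lp.coeFn_add _ _).trans (a1.add b1),
        (Lp.coeFn_add _ _).trans ((a2.add b2).trans (ae_of_all _ fun x => ?_))⟩
      simp only [gradient, Pi.add_apply]
      rw [fderiv_add (hφ.differentiable x) (hψ.differentiable x), map_add]
    · rintro c v - ⟨φ, hφ, a1, a2⟩
      refine ⟨c • φ, hφ.const_smul c, (Lp.coeFn_smul _ _).trans (a1.const_smul c),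
        (Lp.coeFn_smul _ _).trans ((a2.const_smul c).trans (ae_of_all _ fun x => ?_))⟩
      simp only [gradient, Pi.smul_apply]
      rw [fderiv_const_smul (hφ.differentiable x), map_smul]
  convert h φ hφ
  exact H1.ext (Lp.ext (h1.trans hφ.fn_toH1.symm)) (Lp.ext (h2.trans hφ.grad_toH1.symm))

/-! ### The Poincaré inequality -/

theorem norm_sq_eq_integral {F : Type*} [NormedAddCommGroup F] [InnerProductSpace ℝ F]
    (g : Lp F 2 (volume.restrict Ω)) : ‖g‖ ^ 2 = ∫ x in Ω, ‖g x‖ ^ 2 := by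
  rw [← real_inner_self_eq_norm_sq, L2.inner_def]
  simp only [real_inner_self_eq_norm_sq]

theorem IsTestFunction.norm_fn_toH1_sq {φ : E d → ℝ} (hφ : IsTestFunction Ω φ) :
    ‖H1.fn hφ.toH1‖ ^ 2 = ∫ x, φ x ^ 2 := by
  rw [norm_sq_eq_integral, ← setIntegral_eq_integral_of_forall_compl_eq_zero (s := Ω)
    (f := fun x => φ x ^ 2) fun x hx => by simp [hφ.eq_zero hx]]
  refine integral_congr_ae ?_
  filter_upwards [hφ.fn_toH1] with x hx
  rw [hx, Real.norm_eq_abs, sq_abs]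

theorem IsTestFunction.norm_grad_toH1_sq {φ : E d → ℝ} (hφ : IsTestFunction Ω φ) :
    ‖H1.grad hφ.toH1‖ ^ 2 = ∫ x, ‖gradient φ x‖ ^ 2 := by
  rw [norm_sq_eq_integral, ← setIntegral_eq_integral_of_forall_compl_eq_zero (s := Ω)
    (f := fun x => ‖gradient φ x‖ ^ 2) fun x hx => by simp [hφ.gradient_eq_zero hx]]
  refine integral_congr_ae ?_
  filter_upwards [hφ.grad_toH1] with x hx
  rw [hx]

theorem IsTestFunction.integrable_clm_mul {φ : E d → ℝ} (hφ : IsTestFunction Ω φ)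
    (l : E d →L[ℝ] ℝ) (v : E d) :
    Integrable (fun x => l x * (2 * φ x * fderiv ℝ φ x v)) volume := by
  have hc := hφ.smooth.continuous
  have hcd := hφ.continuous_fderiv_apply v
  have h : HasCompactSupport fun x => 2 * φ x * fderiv ℝ φ x v :=
    (hφ.hasCompactSupport_fderiv_apply v).mul_left
  exact (l.continuous.mul ((continuous_const.mul hc).mul hcd)).integrable_of_hasCompactSupport
    h.mul_left

theorem hasCompactSupport_sq {g : E d → ℝ} (hg : HasCompactSupport g) :
    HasCompactSupport fun x => g x ^ 2 := by
  simp only [sq]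
  exact hg.mul_left

theorem IsTestFunction.integrable_sq {φ : E d → ℝ} (hφ : IsTestFunction Ω φ) :
    Integrable (fun x => φ x ^ 2) volume :=
  (hφ.smooth.continuous.pow 2).integrable_of_hasCompactSupport
    (hasCompactSupport_sq hφ.compact)

theorem IsTestFunction.integrable_norm_gradient_sq {φ : E d → ℝ} (hφ : IsTestFunction Ω φ) :
    Integrable (fun x => ‖gradient φ x‖ ^ 2) volume := by
  have h : HasCompactSupport (gradient φ) := (hφ.compact.fderiv ℝ).comp_left (map_zero _)
  exact (hφ.continuous_gradient.norm.pow 2).integrable_of_hasCompactSupport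
    (hasCompactSupport_sq h.norm)

/-- Integration by parts after writing the factor 1 as the derivative of `l` along `v`. -/
theorem IsTestFunction.integral_sq_mul {φ : E d → ℝ} (hφ : IsTestFunction Ω φ)
    (l : E d →L[ℝ] ℝ) {v : E d} (hv : l v = 1) :
    ∫ x, φ x ^ 2 = -∫ x, l x * (2 * φ x * fderiv ℝ φ x v) := by
  have hd : ∀ x, fderiv ℝ (fun y => φ y ^ 2) x v = 2 * φ x * fderiv ℝ φ x v := fun x => by
    rw [((hφ.differentiable x).hasFDerivAt.pow 2).fderiv]
    simp
  have hl : ∀ x, fderiv ℝ l x v = 1 := fun x => by rw [l.fderiv, hv]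
  have i3 : Integrable (fun x => l x * φ x ^ 2) volume :=
    (l.continuous.mul (hφ.smooth.continuous.pow 2)).integrable_of_hasCompactSupport
      (hasCompactSupport_sq hφ.compact).mul_left
  have := integral_mul_fderiv_eq_neg_fderiv_mul_of_integrable (μ := (volume : Measure (E d)))
    (f := l) (g := fun y => φ y ^ 2) (v := v)
    (by simpa only [hl, one_mul] using hφ.integrable_sq)
    (by simpa only [hd] using hφ.integrable_clm_mul l v) i3
    (fun x _ => l.differentiableAt) (fun x _ => (hφ.differentiable x).pow 2)
  simp only [hl, hd, one_mul] at this
  linarith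

theorem IsTestFunction.integral_sq_le {φ : E d → ℝ} (hφ : IsTestFunction Ω φ) {R : ℝ}
    (hR : ∀ x ∈ Ω, ‖x‖ ≤ R) (i : Fin d) :
    ∫ x, φ x ^ 2 ≤ (2 * R) ^ 2 * ∫ x, ‖gradient φ x‖ ^ 2 := by
  obtain ⟨v, hv⟩ : ∃ v : E d, ‖v‖ = 1 := ⟨EuclideanSpace.single i 1, by simp⟩
  have hvv : innerSL ℝ v v = 1 := by
    rw [innerSL_apply_apply, real_inner_self_eq_norm_sq, hv, one_pow]
  have iφ := hφ.integrable_sq.const_mul (1 / 2)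
  have ig := hφ.integrable_norm_gradient_sq.const_mul (2 * R ^ 2)
  have hle : ∫ x, φ x ^ 2 ≤ ∫ x, (1 / 2 * φ x ^ 2 + 2 * R ^ 2 * ‖gradient φ x‖ ^ 2) := by
    rw [hφ.integral_sq_mul _ hvv, ← integral_neg]
    refine integral_mono (hφ.integrable_clm_mul _ v).neg (iφ.add ig) fun x => ?_
    by_cases hx : x ∈ Ω
    · have h1 : |⟪v, x⟫_ℝ * fderiv ℝ φ x v| ≤ R * ‖gradient φ x‖ := by
        rw [abs_mul, ← inner_gradient_left]
        refine mul_le_mul ?_ ?_ (abs_nonneg _) ((norm_nonneg x).trans (hR x hx))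
        · exact (abs_real_inner_le_norm v x).trans (by rw [hv, one_mul]; exact hR x hx)
        · exact (abs_real_inner_le_norm _ v).trans (by rw [hv, mul_one])
      have h2 : (⟪v, x⟫_ℝ * fderiv ℝ φ x v) ^ 2 ≤ (R * ‖gradient φ x‖) ^ 2 :=
        sq_le_sq' (neg_le_of_abs_le h1) (le_of_abs_le h1)
      simp only [innerSL_apply_apply]
      -- Young's inequality: with `p = ⟪v, x⟫ * ∂ᵥφ`, the square gives `-2φp ≤ φ²/2 + 2p²`. The half
      -- of `φ²` is absorbed on the left afterwards, which produces the constant `(2R)²`.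
      nlinarith [sq_nonneg (φ x + 2 * (⟪v, x⟫_ℝ * fderiv ℝ φ x v))]
    · simp [hφ.eq_zero hx, hφ.gradient_eq_zero hx]
  rw [integral_add iφ ig, integral_const_mul, integral_const_mul] at hle
  linarith

theorem norm_fn_le_of_mem_H10 {R : ℝ} (hR0 : 0 ≤ R) (hR : ∀ x ∈ Ω, ‖x‖ ≤ R) (i : Fin d)
    {u : H1 Ω} (hu : u ∈ H10 Ω) : ‖H1.fn u‖ ≤ 2 * R * ‖H1.grad u‖ := by
  refine H10_induction (S := {u | ‖H1.fn u‖ ≤ 2 * R * ‖H1.grad u‖}) ?_ (fun φ hφ => ?_) hu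
  · exact isClosed_le (H1.fnL Ω).continuous.norm
      (continuous_const.mul (H1.gradL Ω).continuous.norm)
  · refine (pow_le_pow_iff_left₀ (norm_nonneg _) (by positivity) two_ne_zero).1 ?_
    rw [mul_pow, hφ.norm_fn_toH1_sq, hφ.norm_grad_toH1_sq]
    exact hφ.integral_sq_le hR i

end Homogenization

namespace Homogenization

variable {d : ℕ} {Ω : Set (E d)}

/-! ### The Dirichlet problem -/

/-- Multiplication by an essentially bounded function on `L²(Ω)ᵈ`. -/
noncomputable def mulL {Ω : Set (E d)} (A : Lp ℝ ∞ (volume.restrict Ω)) : L2Vec Ω →L[ℝ] L2Vec Ω :=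
  (ContinuousLinearMap.lsmul ℝ ℝ).holderL (volume.restrict Ω) ∞ 2 2 A

theorem coeFn_mulL {a : E d → ℝ} (ha : MemLp a ∞ (volume.restrict Ω)) (G : L2Vec Ω) :
    mulL (ha.toLp a) G =ᵐ[volume.restrict Ω] fun x => a x • G x := by
  have h := (ContinuousLinearMap.lsmul ℝ ℝ).coeFn_holder (r := 2) (ha.toLp a) G
  refine EventuallyEq.trans h ?_
  filter_upwards [ha.coeFn_toLp] with x hx
  rw [hx, ContinuousLinearMap.lsmul_apply]

/-- The bilinear form `(u, v) ↦ ∫ a ∇u · ∇v` on `H¹(Ω)`. -/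
noncomputable def energyForm {Ω : Set (E d)} (A : Lp ℝ ∞ (volume.restrict Ω)) :
    H1 Ω →L[ℝ] H1 Ω →L[ℝ] ℝ :=
  (innerSL ℝ).bilinearComp ((mulL A).comp (H1.gradL Ω)) (H1.gradL Ω)

/-- The linear form `v ↦ ∫ f v` on `H¹(Ω)`. -/
noncomputable def sourceForm {Ω : Set (E d)} (f : L2 Ω) : H1 Ω →L[ℝ] ℝ :=
  (innerSL ℝ f).comp (H1.fnL Ω)

theorem energyForm_apply (A : Lp ℝ ∞ (volume.restrict Ω)) (u v : H1 Ω) :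
    energyForm A u v = ⟪mulL A (H1.grad u), H1.grad v⟫_ℝ := rfl

theorem sourceForm_apply (f : L2 Ω) (v : H1 Ω) : sourceForm f v = ⟪f, H1.fn v⟫_ℝ := rfl

theorem energyForm_eq_integral {a : E d → ℝ} (ha : MemLp a ∞ (volume.restrict Ω)) (u v : H1 Ω) :
    energyForm (ha.toLp a) u v = ∫ x in Ω, ⟪a x • H1.grad u x, H1.grad v x⟫_ℝ := by
  rw [energyForm_apply, L2.inner_def]
  refine integral_congr_ae ?_
  filter_upwards [coeFn_mulL ha (H1.grad u)] with x hx
  rw [hx]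

theorem energyForm_toH1 {a : E d → ℝ} (ha : MemLp a ∞ (volume.restrict Ω)) (u : H1 Ω)
    {φ : E d → ℝ} (hφ : IsTestFunction Ω φ) :
    energyForm (ha.toLp a) u hφ.toH1 = ∫ x in Ω, ⟪a x • H1.grad u x, gradient φ x⟫_ℝ := by
  rw [energyForm_eq_integral]
  refine integral_congr_ae ?_
  filter_upwards [hφ.grad_toH1] with x hx
  rw [hx]

theorem sourceForm_toH1 (f : L2 Ω) {φ : E d → ℝ} (hφ : IsTestFunction Ω φ) :
    sourceForm f hφ.toH1 = ∫ x in Ω, f x * φ x := by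
  rw [sourceForm_apply, L2.inner_def]
  refine integral_congr_ae ?_
  filter_upwards [hφ.fn_toH1] with x hx
  rw [hx]
  exact mul_comm _ _

/-- Both sides are continuous in the test element for the `H1` norm, so density of test functions in
`H10` turns the weak formulation into the Lax-Milgram form. -/
theorem isDirichletSolution_iff {a : E d → ℝ} (ha : MemLp a ∞ (volume.restrict Ω)) {f : L2 Ω}
    {u : H1 Ω} : IsDirichletSolution Ω a f u ↔
      u ∈ H10 Ω ∧ ∀ v ∈ H10 Ω, energyForm (ha.toLp a) u v = sourceForm f v := by
  refine and_congr_right fun _ => ⟨fun h v hv => ?_, fun h φ hφ => ?_⟩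
  · refine H10_induction (S := {v | energyForm (ha.toLp a) u v = sourceForm f v})
      (isClosed_eq (ContinuousLinearMap.continuous _) (ContinuousLinearMap.continuous _))
      (fun φ hφ => ?_) hv
    exact (energyForm_toH1 ha u hφ).trans ((h φ hφ).trans (sourceForm_toH1 f hφ).symm)
  · rw [← energyForm_toH1 ha u hφ, ← sourceForm_toH1 f hφ]
    exact h _ hφ.toH1_mem

theorem le_energyForm_self {a : E d → ℝ} (ha : MemLp a ∞ (volume.restrict Ω)) {lam : ℝ}
    (hlam : ∀ᵐ x ∂volume.restrict Ω, lam ≤ a x) (u : H1 Ω) :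
    lam * ‖H1.grad u‖ ^ 2 ≤ energyForm (ha.toLp a) u u := by
  rw [energyForm_apply, ← real_inner_self_eq_norm_sq, L2.inner_def, L2.inner_def,
    ← integral_const_mul]
  refine integral_mono_ae ((L2.integrable_inner _ _).const_mul _) (L2.integrable_inner _ _) ?_
  filter_upwards [coeFn_mulL ha (H1.grad u), hlam] with x hx hl
  simp only [hx, real_inner_smul_left, real_inner_self_eq_norm_sq]
  exact mul_le_mul_of_nonneg_right hl (sq_nonneg _)

theorem exists_coercive_H10 [NeZero d] (hΩ : Bornology.IsBounded Ω) :
    ∃ C : ℝ, 0 < C ∧ ∀ u ∈ H10 Ω, ‖u‖ ≤ C * ‖H1.grad u‖ := by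
  obtain ⟨R, hR0, hR⟩ := hΩ.exists_pos_norm_le
  refine ⟨2 * R + 1, by positivity, fun u hu => ?_⟩
  have h := norm_fn_le_of_mem_H10 hR0.le hR (0 : Fin d) hu
  refine (pow_le_pow_iff_left₀ (norm_nonneg _) (by positivity) two_ne_zero).1 ?_
  rw [H1.norm_sq]
  have h2 : ‖H1.fn u‖ ^ 2 ≤ (2 * R * ‖H1.grad u‖) ^ 2 := by gcongr
  nlinarith [mul_nonneg hR0.le (sq_nonneg ‖H1.grad u‖)]

/-- The Lax-Milgram theorem on a closed subspace. -/
theorem existsUnique_of_coercive_on {H : Type*} [NormedAddCommGroup H] [InnerProductSpace ℝ H]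
    (K : Submodule ℝ H) [CompleteSpace K] (B : H →L[ℝ] H →L[ℝ] ℝ) (l : H →L[ℝ] ℝ) {c : ℝ}
    (hc : 0 < c) (hB : ∀ u ∈ K, c * ‖u‖ ^ 2 ≤ B u u) :
    ∃! u, u ∈ K ∧ ∀ v ∈ K, B u v = l v := by
  set B' : K →L[ℝ] K →L[ℝ] ℝ := B.bilinearComp K.subtypeL K.subtypeL
  have hB' : ∀ u v : K, B' u v = B u v := fun _ _ => rfl
  have hcoer : IsCoercive B' := by
    refine ⟨c, hc, fun u => ?_⟩
    rw [mul_assoc, ← sq]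
    exact hB u u.2
  obtain ⟨w, hw⟩ := (InnerProductSpace.toDual ℝ K).surjective (l.comp K.subtypeL)
  have hw' : ∀ v : K, ⟪w, v⟫_ℝ = l v := fun v => by
    rw [← InnerProductSpace.toDual_apply_apply (𝕜 := ℝ), hw]
    rfl
  refine ⟨(hcoer.continuousLinearEquivOfBilin.symm w : K), ⟨Subtype.coe_prop _, fun v hv => ?_⟩,
    fun u ⟨hu, hsol⟩ => ?_⟩
  · have := hcoer.continuousLinearEquivOfBilin_apply
      (hcoer.continuousLinearEquivOfBilin.symm w) ⟨v, hv⟩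
    rw [ContinuousLinearEquiv.apply_symm_apply, hw'] at this
    exact this.symm
  · have : w = hcoer.continuousLinearEquivOfBilin ⟨u, hu⟩ :=
      hcoer.unique_continuousLinearEquivOfBilin fun v => by rw [hw', hB']; exact (hsol v v.2).symm
    rw [this, ContinuousLinearEquiv.symm_apply_apply]

theorem existsUnique_isDirichletSolution [NeZero d] (hΩ : Bornology.IsBounded Ω) {a : E d → ℝ}
    (ha : MemLp a ∞ (volume.restrict Ω)) {lam : ℝ} (hlam0 : 0 < lam)
    (hlam : ∀ᵐ x ∂volume.restrict Ω, lam ≤ a x) (f : L2 Ω) :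
    ∃! u, IsDirichletSolution Ω a f u := by
  obtain ⟨C, hC0, hC⟩ := exists_coercive_H10 hΩ
  simp only [isDirichletSolution_iff ha]
  refine existsUnique_of_coercive_on (H10 Ω) (energyForm (ha.toLp a)) (sourceForm f)
    -- Ellipticity controls only the gradient; the Poincaré bound `‖u‖ ≤ C * ‖∇u‖` converts it to
    -- the full norm at the cost of `C ^ 2`.
    (c := lam / C ^ 2) (by positivity) fun u hu => ?_
  refine le_trans ?_ (le_energyForm_self ha hlam u)
  rw [div_mul_eq_mul_div, mul_div_assoc]
  refine mul_le_mul_of_nonneg_left ?_ hlam0.le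
  rw [div_le_iff₀ (by positivity), mul_comm, ← mul_pow]
  exact pow_le_pow_left₀ (norm_nonneg _) (hC u hu) 2

/-! ### Stability with respect to the coefficient -/

theorem norm_mulL_sub_le {a b : E d → ℝ} (ha : MemLp a ∞ (volume.restrict Ω))
    (hb : MemLp b ∞ (volume.restrict Ω)) {δ : ℝ}
    (hδ : ∀ᵐ x ∂volume.restrict Ω, |b x - a x| ≤ δ) (G : L2Vec Ω) :
    ‖mulL (hb.toLp b) G - mulL (ha.toLp a) G‖ ≤ δ * ‖G‖ := by
  refine Lp.norm_le_mul_norm_of_ae_le_mul ?_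
  filter_upwards [Lp.coeFn_sub (mulL (hb.toLp b) G) (mulL (ha.toLp a) G), coeFn_mulL ha G,
    coeFn_mulL hb G, hδ] with x h1 h2 h3 h4
  rw [h1, Pi.sub_apply, h2, h3, ← sub_smul, norm_smul, Real.norm_eq_abs]
  exact mul_le_mul_of_nonneg_right h4 (norm_nonneg _)

theorem apply_sub_apply {H : Type*} [NormedAddCommGroup H] [NormedSpace ℝ H]
    (B : H →L[ℝ] H →L[ℝ] ℝ) (u v w : H) : B (u - v) w = B u w - B v w := by
  rw [map_sub, sub_apply]

/-- The common source cancels: the difference of the solutions solves a problem driven by `(b -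
a)∇v`. -/
theorem energyForm_sub_self {a b : E d → ℝ} (ha : MemLp a ∞ (volume.restrict Ω))
    (hb : MemLp b ∞ (volume.restrict Ω)) {f : L2 Ω} {u v : H1 Ω}
    (hu : IsDirichletSolution Ω a f u) (hv : IsDirichletSolution Ω b f v) {w : H1 Ω}
    (hw : w ∈ H10 Ω) :
    energyForm (ha.toLp a) (u - v) w =
      ⟪mulL (hb.toLp b) (H1.grad v) - mulL (ha.toLp a) (H1.grad v), H1.grad w⟫_ℝ := by
  have h1 := ((isDirichletSolution_iff ha).1 hu).2 w hw
  have h2 := ((isDirichletSolution_iff hb).1 hv).2 w hw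
  exact (apply_sub_apply (energyForm (ha.toLp a)) u v w).trans
    ((congrArg (fun t => t - energyForm (ha.toLp a) v w) (h1.trans h2.symm)).trans
      (inner_sub_left (𝕜 := ℝ) (mulL (hb.toLp b) (H1.grad v)) (mulL (ha.toLp a) (H1.grad v))
        (H1.grad w)).symm)

/-- The error equation is tested with `u - v` itself, then ellipticity of `a` bounds one side from
below and Cauchy-Schwarz the other from above. -/
theorem norm_grad_sub_le {a b : E d → ℝ} (ha : MemLp a ∞ (volume.restrict Ω))
    (hb : MemLp b ∞ (volume.restrict Ω)) {lam δ : ℝ}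
    (hlam : ∀ᵐ x ∂volume.restrict Ω, lam ≤ a x)
    (hδ : ∀ᵐ x ∂volume.restrict Ω, |b x - a x| ≤ δ) {f : L2 Ω} {u v : H1 Ω}
    (hu : IsDirichletSolution Ω a f u) (hv : IsDirichletSolution Ω b f v) :
    lam * ‖H1.grad (u - v)‖ ≤ δ * ‖H1.grad v‖ := by
  have hδ0 := (norm_nonneg _).trans (norm_mulL_sub_le ha hb hδ (H1.grad v))
  have e := energyForm_sub_self ha hb hu hv (Submodule.sub_mem _ hu.1 hv.1)
  have h1 := (le_energyForm_self ha hlam (u - v)).trans (e.trans_le (real_inner_le_norm _ _))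
  have h2 : lam * ‖H1.grad (u - v)‖ ^ 2 ≤ δ * ‖H1.grad v‖ * ‖H1.grad (u - v)‖ :=
    h1.trans (mul_le_mul_of_nonneg_right (norm_mulL_sub_le ha hb hδ _) (norm_nonneg _))
  have h3 := norm_nonneg (H1.grad (u - v))
  generalize ‖H1.grad (u - v)‖ = r at h2 h3 ⊢
  generalize δ * ‖H1.grad v‖ = s at h2 hδ0 ⊢
  rcases h3.eq_or_lt with h0 | h0
  · rwa [← h0, mul_zero]
  · refine le_of_mul_le_mul_right ?_ h0
    rwa [mul_assoc, ← sq]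

theorem tendsto_of_tendstoUniformlyOn [NeZero d] (hΩ : Bornology.IsBounded Ω)
    (hΩm : MeasurableSet Ω) {a : ℕ → E d → ℝ} {b : E d → ℝ}
    (ha : ∀ n, MemLp (a n) ∞ (volume.restrict Ω)) (hb : MemLp b ∞ (volume.restrict Ω))
    {lam : ℝ} (hlam0 : 0 < lam) (hlam : ∀ n, ∀ x ∈ Ω, lam ≤ a n x)
    (hab : TendstoUniformlyOn a b atTop Ω) {f : L2 Ω} {u : ℕ → H1 Ω} {v : H1 Ω}
    (hu : ∀ n, IsDirichletSolution Ω (a n) f (u n)) (hv : IsDirichletSolution Ω b f v) :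
    Tendsto u atTop (𝓝 v) := by
  obtain ⟨C, hC0, hC⟩ := exists_coercive_H10 hΩ
  rw [Metric.tendsto_atTop']
  intro r hr
  -- The added 1 keeps the denominator positive when `∇v = 0` and makes the final inequality strict.
  set δ := lam * r / (C * (‖H1.grad v‖ + 1))
  have hδ : 0 < δ := by positivity
  obtain ⟨N, hN⟩ := eventually_atTop.1 (Metric.tendstoUniformlyOn_iff.1 hab δ hδ)
  refine ⟨N, fun n hn => ?_⟩
  have key := norm_grad_sub_le (ha n) hb
    ((ae_restrict_iff' hΩm).2 (ae_of_all _ (hlam n)))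
    ((ae_restrict_iff' hΩm).2 (ae_of_all _ fun x hx => (hN n hn.le x hx).le)) (hu n) hv
  have h2 := hC (u n - v) (Submodule.sub_mem _ (hu n).1 hv.1)
  rw [dist_eq_norm]
  refine h2.trans_lt ?_
  have h3 : δ * (C * (‖H1.grad v‖ + 1)) = lam * r := div_mul_cancel₀ _ (by positivity)
  refine lt_of_mul_lt_mul_left ?_ hlam0.le
  calc lam * (C * ‖H1.grad (u n - v)‖) = C * (lam * ‖H1.grad (u n - v)‖) := by ring
    _ ≤ C * (δ * ‖H1.grad v‖) := by gcongr
    _ < C * (δ * (‖H1.grad v‖ + 1)) := by gcongr; linarith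
    _ = lam * r := by rw [← h3]; ring

/-! ### The limit problems -/

/-- Uniqueness of the weak gradient: it integrates to zero against every test function, so the
fundamental lemma of the calculus of variations applies. -/
theorem H1.grad_eq_zero_of_fn_eq_zero (hΩ : IsOpen Ω) {u : H1 Ω} (h : H1.fn u = 0) :
    H1.grad u = 0 := by
  refine Lp.eq_zero_iff_ae_eq_zero.2 ?_
  refine (ae_restrict_iff' hΩ.measurableSet).2 ?_
  refine hΩ.ae_eq_zero_of_integral_contDiff_smul_eq_zero ?_ fun φ h1 h2 h3 => ?_
  · exact locallyIntegrableOn_of_locallyIntegrable_restrict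
      ((Lp.memLp (H1.grad u)).locallyIntegrable (by norm_num))
  · have hφ : IsTestFunction Ω φ := ⟨h1, h2, h3⟩
    have hw := u.2 φ hφ
    have e0 : ∫ x in Ω, H1.fn u x • gradient φ x = 0 := by
      rw [h]
      refine integral_eq_zero_of_ae ?_
      filter_upwards [Lp.coeFn_zero ℝ 2 (volume.restrict Ω)] with x hx
      change (0 : L2 Ω) x • gradient φ x = 0
      rw [hx, Pi.zero_apply, zero_smul]
    rw [← setIntegral_eq_integral_of_forall_compl_eq_zero (s := Ω)
      (f := fun x => φ x • H1.grad u x) fun x hx => by rw [hφ.eq_zero hx, zero_smul]]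
    exact neg_eq_zero.1 (hw.symm.trans e0)

/-- A vanishing solution has vanishing gradient, so `f` is orthogonal to all test functions. -/
theorem eq_zero_of_isDirichletSolution_zero (hΩ : IsOpen Ω) {a : E d → ℝ} {f : L2 Ω} {u : H1 Ω}
    (hu : IsDirichletSolution Ω a f u) (h : H1.fn u = 0) : f = 0 := by
  have hg := H1.grad_eq_zero_of_fn_eq_zero hΩ h
  refine Lp.eq_zero_iff_ae_eq_zero.2 ?_
  refine (ae_restrict_iff' hΩ.measurableSet).2 ?_
  refine hΩ.ae_eq_zero_of_integral_contDiff_smul_eq_zero ?_ fun φ h1 h2 h3 => ?_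
  · exact locallyIntegrableOn_of_locallyIntegrable_restrict
      ((Lp.memLp f).locallyIntegrable (by norm_num))
  · have hφ : IsTestFunction Ω φ := ⟨h1, h2, h3⟩
    have hs := hu.2 φ hφ
    have e0 : ∫ x in Ω, ⟪a x • H1.grad u x, gradient φ x⟫_ℝ = 0 := by
      rw [hg]
      refine integral_eq_zero_of_ae ?_
      filter_upwards [Lp.coeFn_zero (E d) 2 (volume.restrict Ω)] with x hx
      change ⟪a x • (0 : L2Vec Ω) x, gradient φ x⟫_ℝ = 0
      rw [hx, Pi.zero_apply, smul_zero, inner_zero_left]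
    rw [← setIntegral_eq_integral_of_forall_compl_eq_zero (s := Ω)
      (f := fun x => φ x • f x) fun x hx => by rw [hφ.eq_zero hx, zero_smul]]
    simp only [smul_eq_mul, mul_comm (φ _)]
    exact hs.symm.trans e0

theorem H1.fn_smul (c : ℝ) (u : H1 Ω) : H1.fn (c • u) = c • H1.fn u := rfl

theorem IsDirichletSolution.smul {a b : E d → ℝ} {f : L2 Ω} {u : H1 Ω} {c : ℝ}
    (hu : IsDirichletSolution Ω a f u) (hab : ∀ x, b x * c = a x) :
    IsDirichletSolution Ω b f (c • u) := by
  refine ⟨Submodule.smul_mem _ c hu.1, fun φ hφ => ?_⟩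
  rw [← hu.2 φ hφ]
  refine integral_congr_ae ?_
  have : H1.grad (c • u) = c • H1.grad u := rfl
  rw [this]
  filter_upwards [Lp.coeFn_smul c (H1.grad u)] with x hx
  rw [hx, Pi.smul_apply, smul_smul, hab]

/-! ### The annulus -/

theorem isOpen_annulus : IsOpen annulus :=
  (isOpen_lt continuous_const continuous_norm).inter (isOpen_lt continuous_norm continuous_const)

theorem isBounded_annulus : Bornology.IsBounded annulus :=
  Metric.isBounded_ball.subset (s := annulus) (t := Metric.ball 0 2) fun x hx => by
    simpa using hx.2

theorem memLp_coeffScaled (ε : ℝ) : MemLp (coeffScaled ε) ∞ (volume.restrict annulus) :=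
  memLp_top_of_bound
    (continuous_coeff.comp (continuous_const_smul ε⁻¹)).aestronglyMeasurable 3
    (ae_of_all _ fun _ => abs_coeff_le_three _)

theorem memLp_const_annulus (c : ℝ) :
    MemLp (fun _ => c) ∞ (volume.restrict annulus) :=
  memLp_top_const c

theorem existsUnique_coeffScaled (f : L2 annulus) (ε : ℝ) :
    ∃! u, IsDirichletSolution annulus (coeffScaled ε) f u :=
  existsUnique_isDirichletSolution isBounded_annulus (memLp_coeffScaled ε) one_pos
    (ae_of_all _ fun _ => one_le_coeff _) f

theorem existsUnique_const (f : L2 annulus) {c : ℝ} (hc : 0 < c) :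
    ∃! u, IsDirichletSolution annulus (fun _ => c) f u :=
  existsUnique_isDirichletSolution isBounded_annulus (memLp_const_annulus c) hc
    (ae_of_all _ fun _ => le_rfl) f

theorem tendsto_solution {ε : ℕ → ℝ} {c : ℝ}
    (h : TendstoUniformlyOn (fun n => coeffScaled (ε n)) (fun _ => c) atTop annulus)
    {f : L2 annulus} {u : ℕ → H1 annulus} {v : H1 annulus}
    (hu : ∀ n, IsDirichletSolution annulus (coeffScaled (ε n)) f (u n))
    (hv : IsDirichletSolution annulus (fun _ => c) f v) : Tendsto u atTop (𝓝 v) :=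
  tendsto_of_tendstoUniformlyOn isBounded_annulus isOpen_annulus.measurableSet
    (fun n => memLp_coeffScaled (ε n)) (memLp_const_annulus c) one_pos
    (fun _ _ _ => one_le_coeff _) h hu hv

/-- Since `3 * (2/3) = 2`, the multiple `(2/3) u₁` solves the problem with constant 3 and is `u₂` by
uniqueness. Equal `L²` functions would then give `u₁ = (2/3) u₁` in `L²`, hence zero, hence `f = 0`.
-/
theorem fn_ne_fn {f : L2 annulus} (hf : f ≠ 0) {u₁ u₂ : H1 annulus}
    (h₁ : IsDirichletSolution annulus (fun _ => 2) f u₁)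
    (h₂ : IsDirichletSolution annulus (fun _ => 3) f u₂) : H1.fn u₁ ≠ H1.fn u₂ := by
  intro h
  have h3 : IsDirichletSolution annulus (fun _ => 3) f ((2 / 3 : ℝ) • u₁) :=
    h₁.smul fun _ => by norm_num1
  have h4 : (2 / 3 : ℝ) • u₁ = u₂ := (existsUnique_const f three_pos).unique h3 h₂
  have h5 : (2 / 3 : ℝ) • H1.fn u₁ = H1.fn u₁ := by
    rw [← H1.fn_smul, h4, h]
  have h6 : (1 / 3 : ℝ) • H1.fn u₁ = 0 := by
    rw [show (1 / 3 : ℝ) = 1 - 2 / 3 by norm_num, sub_smul, one_smul, h5, sub_self]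
  exact hf (eq_zero_of_isDirichletSolution_zero isOpen_annulus h₁
    ((smul_eq_zero.1 h6).resolve_left (by norm_num)))

end Homogenization

/-! ### Two limits and the failure of homogenization -/

open Homogenization
theorem mainTheorem4 :
    -- the coefficient is admissible, with `p = d = 2`
    (IsElliptic coeff ∧
      MemLp coeff ∞ volume ∧
      (∀ α ∈ Ioo (0 : ℝ) 1, IsBoundedHolder α coeff) ∧
      coeff ∈ discreteA 2 2) ∧
    -- the two sequences of scales
    ((∀ n, 0 < epsOne n) ∧ StrictAnti epsOne ∧
      Tendsto epsOne atTop (𝓝 0)) ∧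
    ((∀ n, 0 < epsTwo n) ∧ StrictAnti epsTwo ∧
      Tendsto epsTwo atTop (𝓝 0)) ∧
    -- uniform convergence of the rescaled coefficients on the annulus
    TendstoUniformlyOn (fun n => coeffScaled (epsOne n))
      (fun _ => 2) atTop annulus ∧
    TendstoUniformlyOn (fun n => coeffScaled (epsTwo n))
      (fun _ => 3) atTop annulus ∧
    ∀ f : L2 annulus,
      -- the problems are well posed
      (∀ ε : ℝ, 0 < ε → ∃! u, IsDirichletSolution annulus
        (coeffScaled ε) f u) ∧
      (∃! u, IsDirichletSolution annulus (fun _ => 2) f u) ∧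
      (∃! u, IsDirichletSolution annulus (fun _ => 3) f u) ∧
      -- the two limits, and the failure of homogenization
      ∀ (u : ℝ → H1 annulus)
        (u₁ u₂ : H1 annulus),
        (∀ ε : ℝ, 0 < ε → IsDirichletSolution annulus
          (coeffScaled ε) f (u ε)) →
        IsDirichletSolution annulus (fun _ => 2) f u₁ →
        IsDirichletSolution annulus (fun _ => 3) f u₂ →
        (Tendsto (fun n => H1.fn (u (epsOne n))) atTop
            (𝓝 (H1.fn u₁)) ∧
          TendstoWeaklyH1 (fun n => u (epsOne n)) u₁) ∧
        (Tendsto (fun n => H1.fn (u (epsTwo n))) atTop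
            (𝓝 (H1.fn u₂)) ∧
          TendstoWeaklyH1 (fun n => u (epsTwo n)) u₂) ∧
        (f ≠ 0 →
          H1.fn u₁ ≠ H1.fn u₂ ∧
          ¬ ∃ v : L2 annulus,
            Tendsto (fun ε => H1.fn (u ε)) (𝓝[>] 0) (𝓝 v)) := by
  have hpos₁ : ∀ n, 0 < epsOne n := fun n => Real.exp_pos _
  have hpos₂ : ∀ n, 0 < epsTwo n := fun n => Real.exp_pos _
  have hlim₁ : Tendsto epsOne atTop (𝓝 0) := tendsto_exp_neg_exp tendsto_scaleOne
  have hlim₂ : Tendsto epsTwo atTop (𝓝 0) := tendsto_exp_neg_exp tendsto_scaleTwo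
  refine ⟨⟨isElliptic_coeff, memLp_coeff, fun α hα => isBoundedHolder_coeff hα,
    coeff_mem_discreteA⟩, ⟨hpos₁, strictAnti_exp_neg_exp strictMono_scaleOne, hlim₁⟩,
    ⟨hpos₂, strictAnti_exp_neg_exp strictMono_scaleTwo, hlim₂⟩,
    tendstoUniformlyOn_coeffScaled_epsOne, tendstoUniformlyOn_coeffScaled_epsTwo, fun f =>
    ⟨fun ε _ => existsUnique_coeffScaled f ε, existsUnique_const f two_pos,
      existsUnique_const f three_pos, fun u u₁ u₂ hu h₁ h₂ => ?_⟩⟩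
  -- Convergence here is in the norm of `H1`; continuity of the inclusion into `L²` and of each
  -- functional gives the two stated modes.
  have t₁ : Tendsto (fun n => u (epsOne n)) atTop (𝓝 u₁) :=
    tendsto_solution tendstoUniformlyOn_coeffScaled_epsOne (fun n => hu _ (hpos₁ n)) h₁
  have t₂ : Tendsto (fun n => u (epsTwo n)) atTop (𝓝 u₂) :=
    tendsto_solution tendstoUniformlyOn_coeffScaled_epsTwo (fun n => hu _ (hpos₂ n)) h₂
  have f₁ : Tendsto (fun n => H1.fn (u (epsOne n))) atTop (𝓝 (H1.fn u₁)) :=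
    ((H1.fnL annulus).continuous.tendsto u₁).comp t₁
  have f₂ : Tendsto (fun n => H1.fn (u (epsTwo n))) atTop (𝓝 (H1.fn u₂)) :=
    ((H1.fnL annulus).continuous.tendsto u₂).comp t₂
  refine ⟨⟨f₁, fun l => (l.continuous.tendsto u₁).comp t₁⟩,
    ⟨f₂, fun l => (l.continuous.tendsto u₂).comp t₂⟩, fun hf => ?_⟩
  have hne := fn_ne_fn hf h₁ h₂
  refine ⟨hne, fun ⟨v, hv⟩ => hne ?_⟩
  -- Positivity of the scales places both sequences in the right-hand filter at 0, so a limit `v`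
  -- would equal both `H1.fn u₁` and `H1.fn u₂`.
  have g₁ : Tendsto epsOne atTop (𝓝[>] 0) :=
    tendsto_nhdsWithin_iff.2 ⟨hlim₁, Eventually.of_forall hpos₁⟩
  have g₂ : Tendsto epsTwo atTop (𝓝[>] 0) :=
    tendsto_nhdsWithin_iff.2 ⟨hlim₂, Eventually.of_forall hpos₂⟩
  exact (tendsto_nhds_unique f₁ (hv.comp g₁)).trans (tendsto_nhds_unique f₂ (hv.comp g₂)).symm
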